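/- Let $\mathcal T$ be a compactly generated triangulated category, i.e. $\mathcal T$ has small coproducts and there is a set $\mathcal G$ of compact objects such that every $y$ with $\mathrm{Hom}(g,y[n])=0$ for all $g\in\mathcal G$, $n\in\mathbb Z$ is zero. Let $\mathcal T^{\mathsf c}$ be its subcategory of compact objects. For a class $\mathcal X$ of objects put $$\mathcal X^{\Diamond}=\{t:\ \forall x\in\mathcal X,\ \mathrm{Hom}(x,t[n])=0\text{ for }|n|\gg0\},\qquad {}^{\Diamond}\mathcal X=\{t:\ \forall x\in\mathcal X,\ \mathrm{Hom}(t,x[n])=0\text{ for }|n|\gg0\}$$ (the right and left far-away orthogonals), and let $\mathcal T^{\mathsf b}=(\mathcal T^{\mathsf c})^{\Diamond}$, $\mathcal T^{\mathsf b}_p={}^{\Diamond}(\mathcal T^{\mathsf b})$, $\mathcal T^{\mathsf b}_i=(\mathcal T^{\mathsf b})^{\Diamond}$. One says that $\mathcal T$ has finite global dimension if $\mathcal T^{\mathsf b}=\mathcal T^{\mathsf b}_p$. Let $M$ be a compact silting object of $\mathcal T$, i.e. $M$ is compact, $\mathrm{Hom}(M,M[i])=0$ for all $i>0$, and $\mathsf{thick}(M)=\mathcal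 T^{\mathsf c}$. Let $\mathcal H_M=\{y:\ \mathrm{Hom}(M,y[i])=0\ \text{for all } i\neq0\}$, the heart of the t-structure $(M^{\perp_{>0}},M^{\perp_{\le0}})$. For an object $x$, let $\mathrm{pd}_{\mathcal H_M}x$ be the minimum integer $n$ with $\mathrm{Hom}(x,y[i])=0$ for all $y\in\mathcal H_M$ and all $i>n$, and let $\mathrm{gl.dim}_{\mathcal H_M}\mathcal T$ be the minimum integer $n$ with $\mathrm{pd}_{\mathcal H_M}x\le n$ for all $x\in\mathcal H_M$ (in both cases $\infty$ if no such $n$ exists, and $-\infty$ if every $n$ works). **Theorem.** The following are equivalent: 1. $\mathrm{gl.dim}_{\mathcal H_M}\mathcal T<\infty$; 2. $\mathcal T^{\mathsf b}\subseteq\mathcal T^{\mathsf b}_p$; 3. $\mathcal T^{\mathsf b}\subseteq\mathcal T^{\mathsf b}_i$. If moreover $M\in \{M\}^{\Diamond}$, then $\mathrm{gl.dim}_{\mathcal H_M}\mathcal T<\infty$ if and only if $\mathcal T$ has finite global dimension. Finally, finiteness of the relative global dimension does not depend on the choice of $M$: for every compact silting object $N$ of $\mathcal T$, $\mathrm{gl.dim}_{\mathcal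 H_M}\mathcal T<\infty$ if and only if $\mathrm{gl.dim}_{\mathcal H_N}\mathcal T<\infty$. -/

import Mathlib

open CategoryTheory CategoryTheory.Limits CategoryTheory.Pretriangulated

universe v u

namespace RelGlobalDim

section Definitions

variable {C : Type u} [Category.{v} C] [Preadditive C] [HasZeroObject C] [HasShift C ℤ]
  [∀ n : ℤ, (shiftFunctor C n).Additive] [Pretriangulated C]

/-- The compact objects: those `X` for which `Hom(X, -)`, as a functor to abelian groups,
preserves all small coproducts. -/
def compactObjects (C : Type u) [Category.{v} C] [Preadditive C] : ObjectProperty C :=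
  fun X => ∀ J : Type v,
    Nonempty (PreservesColimitsOfShape (Discrete J) (preadditiveCoyoneda.obj (Opposite.op X)))

/-- A triangulated category is compactly generated if it has all small coproducts and there is
a (small) set of compact objects `G i` such that only zero objects `Y` satisfy
`Hom(G i, Y[n]) = 0` for all `i` and all `n`. -/
structure IsCompactlyGenerated (C : Type u) [Category.{v} C] [Preadditive C] [HasShift C ℤ] :
    Prop where
  hasCoproducts : HasCoproducts.{v} C
  exists_generators : ∃ (ι : Type v) (G : ι → C), (∀ i, compactObjects C (G i)) ∧
    ∀ Y : C, (∀ (i : ι) (n : ℤ) (f : G i ⟶ Y⟦n⟧), f = 0) → IsZero Y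

/-- `𝒳^{⊥_I}`: the objects `y` with `Hom(x, y[i]) = 0` for all `x` in `𝒳` and all `i ∈ I`. -/
def perp (𝒳 : ObjectProperty C) (I : Set ℤ) : ObjectProperty C :=
  fun y => ∀ x : C, 𝒳 x → ∀ i ∈ I, ∀ f : x ⟶ y⟦i⟧, f = 0

/-- The right far-away orthogonal of `𝒳`: the objects `t` such that for every `x` in `𝒳`,
`Hom(x, t[n]) = 0` for `|n| ≫ 0`. -/
def rightFarAway (𝒳 : ObjectProperty C) : ObjectProperty C :=
  fun t => ∀ x : C, 𝒳 x → ∃ N : ℕ, ∀ n : ℤ, (N : ℤ) < |n| → ∀ f : x ⟶ t⟦n⟧, f = 0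

/-- The left far-away orthogonal of `𝒳`: the objects `t` such that for every `x` in `𝒳`,
`Hom(t, x[n]) = 0` for `|n| ≫ 0`. -/
def leftFarAway (𝒳 : ObjectProperty C) : ObjectProperty C :=
  fun t => ∀ x : C, 𝒳 x → ∃ N : ℕ, ∀ n : ℤ, (N : ℤ) < |n| → ∀ f : t ⟶ x⟦n⟧, f = 0

/-- The bounded objects `T^b`. -/
def boundedObjects (C : Type u) [Category.{v} C] [Preadditive C] [HasShift C ℤ] :
    ObjectProperty C :=
  rightFarAway (compactObjects C)

/-- The bounded projective objects `T^b_p`. -/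
def boundedProjectives (C : Type u) [Category.{v} C] [Preadditive C] [HasShift C ℤ] :
    ObjectProperty C :=
  leftFarAway (boundedObjects C)

/-- The bounded injective objects `T^b_i`. -/
def boundedInjectives (C : Type u) [Category.{v} C] [Preadditive C] [HasShift C ℤ] :
    ObjectProperty C :=
  rightFarAway (boundedObjects C)

/-- `T` has finite global dimension if `T^b = T^b_p`. -/
def HasFiniteGlobalDimension (C : Type u) [Category.{v} C] [Preadditive C] [HasShift C ℤ] :
    Prop :=
  boundedObjects C = boundedProjectives C

/-- `M` is a compact silting object: a compact object with `Hom(M, M[i]) = 0` for all `i > 0`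
whose thick closure is the subcategory of compact objects. As the latter is itself thick, the
thick closure may be computed in the ambient category. -/
structure IsCompactSilting (M : C) : Prop where
  compact : compactObjects C M
  hom_shift_eq_zero : ∀ i : ℤ, 0 < i → ∀ f : M ⟶ M⟦i⟧, f = 0
  thick_eq : (ObjectProperty.singleton M).triangEnvelope = compactObjects C

/-- The heart `ℋ_M = M^{⊥_{≠ 0}}` attached to an object `M`; when `M` is compact silting this is
the heart of the t-structure with aisle `M^{⊥_{> 0}}` and coaisle `M^{⊥_{≤ 0}}`. -/
def siltingHeart (M : C) : ObjectProperty C :=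
  perp (ObjectProperty.singleton M) {i | i ≠ 0}

/-- The projective dimension of `x` relative to `ℋ`: the least integer `n` such that
`Hom(x, y[i]) = 0` for all `y` in `ℋ` and all `i > n`. It is `⊤` if no integer has this property
and `⊥` if all integers have it. -/
noncomputable def projDim (ℋ : ObjectProperty C) (x : C) : WithBot (WithTop ℤ) :=
  sInf {m | ∃ n : ℤ, m = ((n : WithTop ℤ) : WithBot (WithTop ℤ)) ∧
    ∀ y : C, ℋ y → ∀ i : ℤ, n < i → ∀ f : x ⟶ y⟦i⟧, f = 0}

/-- The global dimension relative to `ℋ`: the least integer `n` such that every object of `ℋ` has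
projective dimension at most `n` relative to `ℋ`. It is `⊤` if no integer has this property and
`⊥` if all integers have it. -/
noncomputable def globalDim (ℋ : ObjectProperty C) : WithBot (WithTop ℤ) :=
  sInf {m | ∃ n : ℤ, m = ((n : WithTop ℤ) : WithBot (WithTop ℤ)) ∧
    ∀ x : C, ℋ x → projDim ℋ x ≤ ((n : WithTop ℤ) : WithBot (WithTop ℤ))}

end Definitions

end RelGlobalDim

namespace RelGlobalDim

/-! ### Morphisms from a compact object into a coproduct -/

section Coproducts

variable {C : Type u} [Category.{v} C] [Preadditive C]

/-! Conditions 1, 2 and 3 are all equivalent to `BoundedExt`: bounded `t`, `s` satisfy `Hom(t, s[n])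
= 0` for almost all `n`. As this does not mention `M`, independence of `M` follows.

If the global dimension is finite, truncations build every bounded object from shifts of heart
objects (`bounded_induction`). Between heart objects, large positive degrees vanish by hypothesis
and negative ones by orthogonality of aisle and coaisle. Conversely, nonzero maps `x_n ⟶ y_n[i_n]`
with `i_n > n` would all survive between `∐ x_n` and `∐ y_n`. These lie in the heart because `M` is
compact, which contradicts `BoundedExt`.

If `M ∈ {M}^◇`, also `T^b_p ⊆ T^b`. A weak form of Brown–Comenetz duality
(`exists_character_detecting`) yields a bounded test object `I` that detects `Hom(M, t[n])` for all
`n` at once.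

Truncations and test objects are homotopy colimits of iterated cones. -/

lemma compactObjects.preservesColimitsOfShape {A : C} (hA : compactObjects C A)
    (J : Type*) [Small.{v} J] :
    PreservesColimitsOfShape (Discrete J) (preadditiveCoyoneda.obj (Opposite.op A)) := by
  have := (hA (Shrink.{v} J)).some
  exact preservesColimitsOfShape_of_equiv (Discrete.equivalence (equivShrink.{v} J).symm) _

/-- The cocone exhibiting `Hom(A, ∐ X)` as the direct sum of the `Hom(A, X j)`. -/
noncomputable def compactObjects.isColimit {A : C} (hA : compactObjects C A)
    {J : Type*} [Small.{v} J] (X : J → C) [HasCoproduct X] :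
    IsColimit ((preadditiveCoyoneda.obj (Opposite.op A)).mapCocone
      (colimit.cocone (Discrete.functor X))) :=
  have := hA.preservesColimitsOfShape J
  isColimitOfPreserves _ (colimit.isColimit _)

lemma compactObjects.sigma_induction {A : C} (hA : compactObjects C A)
    {J : Type*} [Small.{v} J] (X : J → C) [HasCoproduct X] {p : (A ⟶ ∐ X) → Prop}
    (zero : p 0) (add : ∀ f g, p f → p g → p (f + g))
    (ι : ∀ j (f : A ⟶ X j), p (f ≫ Sigma.ι X j)) (f : A ⟶ ∐ X) : p f := by
  let S : AddSubgroup (A ⟶ ∐ X) := AddSubgroup.closure {f | ∃ j g, f = g ≫ Sigma.ι X j}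
  -- The quotient by `S` kills every coprojection of the direct sum, hence is zero.
  have key : AddCommGrpCat.ofHom (QuotientAddGroup.mk' S) = 0 := by
    refine (hA.isColimit X).hom_ext fun ⟨j⟩ => ?_
    ext (g : A ⟶ X j)
    exact (QuotientAddGroup.eq_zero_iff (N := S) _).2 (AddSubgroup.subset_closure ⟨j, g, rfl⟩)
  have hf : f ∈ S := (QuotientAddGroup.eq_zero_iff (N := S) f).1 (ConcreteCategory.congr_hom key f)
  induction hf using AddSubgroup.closure_induction_left with
  | zero => exact zero
  | add_left x hx y hy ih =>
    obtain ⟨j, g, rfl⟩ := hx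
    exact add _ _ (ι _ _) ih
  | neg_add_cancel x hx y hy ih =>
    obtain ⟨j, g, rfl⟩ := hx
    rw [← Preadditive.neg_comp]
    exact add _ _ (ι _ _) ih

lemma compactObjects.exists_sigma_desc {A : C} (hA : compactObjects C A)
    {J : Type*} [Small.{v} J] (X : J → C) [HasCoproduct X]
    (χ : ∀ j, CharacterModule (A ⟶ X j)) :
    ∃ χ' : CharacterModule (A ⟶ ∐ X), ∀ j (f : A ⟶ X j), χ' (f ≫ Sigma.ι X j) = χ j f := by
  let B := AddCommGrpCat.of (ULift.{v} (AddCircle (1 : ℚ)))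
  let c : Cocone (Discrete.functor X ⋙ preadditiveCoyoneda.obj (Opposite.op A)) :=
    { pt := B
      ι := Discrete.natTrans fun ⟨j⟩ =>
        AddCommGrpCat.ofHom (AddEquiv.ulift.symm.toAddMonoidHom.comp (χ j)) }
  refine ⟨AddEquiv.ulift.toAddMonoidHom.comp ((hA.isColimit X).desc c).hom, fun j f => ?_⟩
  have := ConcreteCategory.congr_hom ((hA.isColimit X).fac c ⟨j⟩) f
  exact congrArg ULift.down this

/-- The projections from a coproduct onto its summands. -/
noncomputable def sigmaProj {J : Type*} [DecidableEq J] (X : J → C) [HasCoproduct X] (j : J) :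
    ∐ X ⟶ X j :=
  Sigma.desc fun i => if h : i = j then eqToHom (by rw [h]) else 0

lemma ι_sigmaProj_self {J : Type*} [DecidableEq J] (X : J → C) [HasCoproduct X] (j : J) :
    Sigma.ι X j ≫ sigmaProj X j = 𝟙 _ := by
  simp [sigmaProj]

lemma ι_sigmaProj_of_ne {J : Type*} [DecidableEq J] (X : J → C) [HasCoproduct X] {i j : J}
    (h : i ≠ j) : Sigma.ι X i ≫ sigmaProj X j = 0 := by
  simp [sigmaProj, h]

variable (X : ℕ → C) (φ : ∀ n, X n ⟶ X (n + 1)) [HasCoproduct X]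

/-- The difference of the identity and the shift map on the coproduct of a sequence. -/
noncomputable def idSubShift : ∐ X ⟶ ∐ X :=
  Sigma.desc fun n => Sigma.ι X n - φ n ≫ Sigma.ι X (n + 1)

lemma ι_idSubShift (n : ℕ) :
    Sigma.ι X n ≫ idSubShift X φ = Sigma.ι X n - φ n ≫ Sigma.ι X (n + 1) := by
  simp [idSubShift]

lemma idSubShift_sigmaProj_zero : idSubShift X φ ≫ sigmaProj X 0 = sigmaProj X 0 := by
  refine Sigma.hom_ext _ _ fun n => ?_
  rw [← Category.assoc, ι_idSubShift, Preadditive.sub_comp, Category.assoc,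
    ι_sigmaProj_of_ne X (Nat.succ_ne_zero n)]
  simp

lemma idSubShift_sigmaProj_succ (j : ℕ) :
    idSubShift X φ ≫ sigmaProj X (j + 1) = sigmaProj X (j + 1) - sigmaProj X j ≫ φ j := by
  refine Sigma.hom_ext _ _ fun n => ?_
  rw [← Category.assoc, ι_idSubShift, Preadditive.sub_comp, Category.assoc,
    Preadditive.comp_sub, ← Category.assoc (Sigma.ι X n)]
  by_cases h : n = j
  · subst h
    simp [ι_sigmaProj_self]
  · rw [ι_sigmaProj_of_ne X h, ι_sigmaProj_of_ne X (fun h' => h (Nat.succ_injective h'))]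
    simp

variable {A : C} (hA : compactObjects C A)
include hA

lemma eventually_comp_sigmaProj (g : A ⟶ ∐ X) : ∃ N, ∀ n, N ≤ n → g ≫ sigmaProj X n = 0 := by
  induction g using hA.sigma_induction X with
  | zero => exact ⟨0, by simp⟩
  | add f g hf hg =>
    obtain ⟨N, hN⟩ := hf
    obtain ⟨N', hN'⟩ := hg
    refine ⟨max N N', fun n hn => ?_⟩
    rw [Preadditive.add_comp, hN n (by omega), hN' n (by omega), add_zero]
  | ι j f =>
    refine ⟨j + 1, fun n hn => ?_⟩
    rw [Category.assoc, ι_sigmaProj_of_ne X (by omega), comp_zero]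

lemma eq_zero_of_comp_sigmaProj (g : A ⟶ ∐ X) (hg : ∀ n, g ≫ sigmaProj X n = 0) : g = 0 := by
  have : ∃ N, g = ∑ i ∈ Finset.range N, g ≫ sigmaProj X i ≫ Sigma.ι X i := by
    suffices ∃ N, ∀ n, N ≤ n → g = ∑ i ∈ Finset.range n, g ≫ sigmaProj X i ≫ Sigma.ι X i from
      this.imp fun N hN => hN N le_rfl
    clear hg
    induction g using hA.sigma_induction X with
    | zero => exact ⟨0, by simp⟩
    | add f g hf hg =>
      obtain ⟨N, hN⟩ := hf
      obtain ⟨N', hN'⟩ := hg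
      refine ⟨max N N', fun n hn => ?_⟩
      simp only [Preadditive.add_comp, Finset.sum_add_distrib]
      rw [← hN n (by omega), ← hN' n (by omega)]
    | ι j f =>
      refine ⟨j + 1, fun n hn => ?_⟩
      rw [Finset.sum_eq_single_of_mem j (Finset.mem_range.2 hn)]
      · rw [Category.assoc, ← Category.assoc (Sigma.ι X j), ι_sigmaProj_self, Category.id_comp]
      · intro b _ hb
        rw [Category.assoc, ← Category.assoc (Sigma.ι X j), ι_sigmaProj_of_ne X hb.symm,
          zero_comp, comp_zero]
  obtain ⟨N, hN⟩ := this
  rw [hN]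
  exact Finset.sum_eq_zero fun i _ => by rw [← Category.assoc, hg, zero_comp]

/-- Coordinates satisfy `g_0 = 0` and `g_{n+1} = g_n ≫ φ n`, and a morphism from a compact object is
determined by its coordinates. -/
lemma eq_zero_of_comp_idSubShift (g : A ⟶ ∐ X) (hg : g ≫ idSubShift X φ = 0) : g = 0 := by
  refine eq_zero_of_comp_sigmaProj X hA g fun n => ?_
  induction n with
  | zero => rw [← idSubShift_sigmaProj_zero X φ, ← Category.assoc, hg, zero_comp]
  | succ n ih =>
    have h := congrArg (g ≫ ·) (idSubShift_sigmaProj_succ X φ n)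
    simp only [← Category.assoc, hg, Preadditive.comp_sub, ih, zero_comp, sub_zero] at h
    exact h.symm

end Coproducts

/-- `ℚ/ℤ` is injective, so the character induced on `G / ker f` extends along its embedding into
`H`. -/
lemma exists_character_extension {G H : Type*} [AddCommGroup G] [AddCommGroup H] (f : G →+ H)
    (χ : CharacterModule G) (h : ∀ g, f g = 0 → χ g = 0) :
    ∃ χ' : CharacterModule H, ∀ g, χ' (f g) = χ g := by
  obtain ⟨χ', h'⟩ := CharacterModule.dual_surjective_of_injective
    (QuotientAddGroup.kerLift f).toIntLinearMap (QuotientAddGroup.kerLift_injective f)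
    (QuotientAddGroup.lift f.ker χ h)
  exact ⟨χ', fun g => DFunLike.congr_fun h' (QuotientAddGroup.mk g)⟩

/-! ### Homotopy colimits of sequences -/

section Telescope

variable {C : Type u} [Category.{v} C] [Preadditive C] [HasZeroObject C] [HasShift C ℤ]
  [∀ n : ℤ, (shiftFunctor C n).Additive] [Pretriangulated C]

section DistTriang

variable {X Y Z A : C} {f : X ⟶ Y} {g : Y ⟶ Z} {h : Z ⟶ X⟦(1 : ℤ)⟧}
  (hT : Triangle.mk f g h ∈ distTriang C)
include hT

lemma distTriang_lift₁ (k : A ⟶ Y) (hk : k ≫ g = 0) : ∃ l : A ⟶ X, l ≫ f = k :=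
  (Triangle.coyoneda_exact₂ _ hT k hk).imp fun _ => Eq.symm

lemma distTriang_lift₂ (k : A ⟶ Z) (hk : k ≫ h = 0) : ∃ l : A ⟶ Y, l ≫ g = k :=
  (Triangle.coyoneda_exact₃ _ hT k hk).imp fun _ => Eq.symm

lemma distTriang_lift₃ (k : A ⟶ X⟦(1 : ℤ)⟧) (hk : k ≫ f⟦(1 : ℤ)⟧' = 0) : ∃ l : A ⟶ Z, l ≫ h = k :=
  (Triangle.coyoneda_exact₁ _ hT k hk).imp fun _ => Eq.symm

lemma distTriang_desc₃ (k : Y ⟶ A) (hk : f ≫ k = 0) : ∃ l : Z ⟶ A, g ≫ l = k :=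
  (Triangle.yoneda_exact₂ _ hT k hk).imp fun _ => Eq.symm

lemma distTriang_mor_zero₁₂ : f ≫ g = 0 := comp_distTriang_mor_zero₁₂ _ hT

lemma distTriang_mor_zero₂₃ : g ≫ h = 0 := comp_distTriang_mor_zero₂₃ _ hT

lemma distTriang_mor_zero₃₁ : h ≫ f⟦(1 : ℤ)⟧' = 0 := comp_distTriang_mor_zero₃₁ _ hT

lemma distTriang_exists_character (χ : CharacterModule (A ⟶ Y))
    (hχ : ∀ k : A ⟶ X, χ (k ≫ f) = 0) :
    ∃ χ' : CharacterModule (A ⟶ Z), ∀ k, χ' (k ≫ g) = χ k :=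
  exists_character_extension (Preadditive.rightComp A g) χ fun k hk => by
    obtain ⟨l, rfl⟩ := distTriang_lift₁ hT k hk
    exact hχ l

end DistTriang

variable (X : ℕ → C) (φ : ∀ n, X n ⟶ X (n + 1)) [HasCoproduct X]

variable (X : ℕ → C) (φ : ∀ n, X n ⟶ X (n + 1)) [HasCoproduct X]

/-- A homotopy colimit `L` of a sequence `X 0 ⟶ X 1 ⟶ ⋯`, with the properties of the maps
`Hom(A, X n) ⟶ Hom(A, L)` for compact `A`, and the weak universal property of `L`. -/
lemma exists_homotopyColimit : ∃ (L : C) (ι : ∀ n, X n ⟶ L), (∀ n, φ n ≫ ι (n + 1) = ι n) ∧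
    (∀ A : C, compactObjects C A → compactObjects C (A⟦(-1 : ℤ)⟧) →
      ∀ f : A ⟶ L, ∃ n g, f = g ≫ ι n) ∧
    (∀ A : C, compactObjects C A → (∀ n (f : A ⟶ X n), f ≫ φ n = 0 → f = 0) →
      ∀ n (f : A ⟶ X n), f ≫ ι n = 0 → f = 0) ∧
    (∀ (Y : C) (ψ : ∀ n, X n ⟶ Y), (∀ n, φ n ≫ ψ (n + 1) = ψ n) →
      ∃ ψ' : L ⟶ Y, ∀ n, ι n ≫ ψ' = ψ n) ∧
    (∀ A : C, compactObjects C A → ∀ χ : ∀ n, CharacterModule (A ⟶ X n),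
      (∀ n f, χ (n + 1) (f ≫ φ n) = χ n f) →
      ∃ χ' : CharacterModule (A ⟶ L), ∀ n f, χ' (f ≫ ι n) = χ n f) := by
  obtain ⟨L, p, d, hT⟩ := distinguished_cocone_triangle (idSubShift X φ)
  have hp : idSubShift X φ ≫ p = 0 := distTriang_mor_zero₁₂ hT
  have hι (n : ℕ) : φ n ≫ Sigma.ι X (n + 1) ≫ p = Sigma.ι X n ≫ p := by
    have := congrArg (Sigma.ι X n ≫ ·) hp
    simp only [← Category.assoc, ι_idSubShift, Preadditive.sub_comp, comp_zero] at this
    simpa using (sub_eq_zero.1 this).symm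
  refine ⟨L, fun n => Sigma.ι X n ≫ p, hι, ?_, ?_, ?_, ?_⟩
  · intro A hA hA' f
    -- After shifting by `-1`, `f ≫ d` becomes a map `A[-1] ⟶ ∐ X` killed by `idSubShift`; this is
    -- where compactness of `A[-1]` enters.
    have hd : f ≫ d = 0 := by
      have hz := distTriang_mor_zero₃₁ hT
      let e := shiftFunctorCompIsoId C (1 : ℤ) (-1) (by simp)
      have h1 : (f ≫ d)⟦(-1 : ℤ)⟧' ≫ e.hom.app (∐ X) = 0 := by
        refine eq_zero_of_comp_idSubShift X φ hA' _ ?_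
        have he := e.hom.naturality (idSubShift X φ)
        dsimp at he
        rw [Category.assoc, ← he, ← Category.assoc, ← Functor.map_comp, Category.assoc, hz]
        simp
      rw [← cancel_mono (e.inv.app (∐ X)), Category.assoc, Iso.hom_inv_id_app, zero_comp] at h1
      exact (shiftFunctor C (-1 : ℤ)).map_injective
        (by rw [Functor.map_zero]; exact (Category.comp_id _).symm.trans h1)
    obtain ⟨g, rfl⟩ := distTriang_lift₂ hT f hd
    clear hd
    -- Asking for all large `n` lets two factorizations be added at a common stage.
    suffices ∃ N, ∀ n, N ≤ n → ∃ h, g ≫ p = h ≫ Sigma.ι X n ≫ p by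
      obtain ⟨N, hN⟩ := this
      exact ⟨N, hN N le_rfl⟩
    induction g using hA.sigma_induction X with
    | zero => exact ⟨0, fun n _ => ⟨0, by simp⟩⟩
    | add f g hf hg =>
      obtain ⟨N, hN⟩ := hf
      obtain ⟨N', hN'⟩ := hg
      refine ⟨max N N', fun n hn => ?_⟩
      obtain ⟨h, hh⟩ := hN n (by omega)
      obtain ⟨h', hh'⟩ := hN' n (by omega)
      exact ⟨h + h', by simp only [Preadditive.add_comp, hh, hh']⟩
    | ι j f =>
      refine ⟨j, fun n hn => ?_⟩
      induction n, hn using Nat.le_induction with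
      | base => exact ⟨f, by simp⟩
      | succ n hn ih =>
        obtain ⟨h, hh⟩ := ih
        exact ⟨h ≫ φ n, by rw [hh, Category.assoc, hι]⟩
  · intro A hA hφ n f hf
    obtain ⟨g, hg⟩ := distTriang_lift₁ hT (f ≫ Sigma.ι X n) (by rw [Category.assoc, hf])
    -- The coordinates of `g` vanish below `n`, equal `f` at `n`, and are then pushed along the
    -- injective maps `φ`. Only finitely many are nonzero, so `f = 0`.
    have h0 : ∀ m, m < n → g ≫ sigmaProj X m = 0 := by
      intro m
      induction m with
      | zero =>
        intro hm
        rw [← idSubShift_sigmaProj_zero X φ, ← Category.assoc, hg, Category.assoc,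
          ι_sigmaProj_of_ne X hm.ne', comp_zero]
      | succ m ih =>
        intro hm
        have h := congrArg (g ≫ ·) (idSubShift_sigmaProj_succ X φ m)
        simp only [← Category.assoc, hg, Preadditive.comp_sub, ih (by omega)] at h
        rw [Category.assoc, ι_sigmaProj_of_ne X hm.ne'] at h
        simpa using h.symm
    have h1 : g ≫ sigmaProj X n = f := by
      cases n with
      | zero =>
        rw [← idSubShift_sigmaProj_zero X φ, ← Category.assoc, hg, Category.assoc,
          ι_sigmaProj_self, Category.comp_id]
      | succ n =>
        have h := congrArg (g ≫ ·) (idSubShift_sigmaProj_succ X φ n)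
        simp only [← Category.assoc, hg, Preadditive.comp_sub, h0 n (by omega)] at h
        rw [Category.assoc, ι_sigmaProj_self] at h
        simpa using h.symm
    have h2 : ∀ m, n ≤ m → g ≫ sigmaProj X m = 0 → f = 0 := by
      intro m hm
      induction m, hm using Nat.le_induction with
      | base => rw [h1]; exact id
      | succ m hm ih =>
        intro hz
        have h := congrArg (g ≫ ·) (idSubShift_sigmaProj_succ X φ m)
        simp only [← Category.assoc, hg, Preadditive.comp_sub, hz] at h
        rw [Category.assoc, ι_sigmaProj_of_ne X (by omega), comp_zero, zero_sub, eq_comm,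
          neg_eq_zero] at h
        exact ih (hφ _ _ h)
    obtain ⟨N, hN⟩ := eventually_comp_sigmaProj X hA g
    exact h2 (max n N) (by omega) (hN _ (by omega))
  · intro Y ψ hψ
    obtain ⟨ψ', hψ'⟩ := distTriang_desc₃ hT (Sigma.desc ψ) (by
      refine Sigma.hom_ext _ _ fun n => ?_
      rw [← Category.assoc, ι_idSubShift]
      simp [hψ])
    exact ⟨ψ', fun n => by rw [Category.assoc, hψ', Sigma.ι_desc]⟩
  · intro A hA χ hχ
    obtain ⟨χ', hχ'⟩ := hA.exists_sigma_desc X χ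
    obtain ⟨χ'', h''⟩ := distTriang_exists_character hT χ' (by
      intro f
      induction f using hA.sigma_induction X with
      | zero => simp
      | add f g hf hg => rw [Preadditive.add_comp, map_add, hf, hg, add_zero]
      | ι j f =>
        rw [Category.assoc, ι_idSubShift, Preadditive.comp_sub, map_sub, ← Category.assoc,
          hχ', hχ', hχ, sub_self])
    exact ⟨χ'', fun n f => by rw [← Category.assoc, ← hχ']; rw [h'']⟩

end Telescope

/-! ### Vanishing of Hom groups and shifts -/

section Orthogonality

variable {C : Type u} [Category.{v} C] [Preadditive C]

/-- All morphisms from `X` to `Y` are zero. -/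
def HomVanishes (X Y : C) : Prop := ∀ f : X ⟶ Y, f = 0

lemma HomVanishes.of_iso {X X' Y Y' : C} (h : HomVanishes X Y) (e : X ≅ X') (e' : Y ≅ Y') :
    HomVanishes X' Y' := fun f => by
  rw [← cancel_epi e.hom, ← cancel_mono e'.inv, h ((e.hom ≫ f) ≫ e'.inv)]
  simp

lemma homVanishes_congr {X X' Y Y' : C} (e : X ≅ X') (e' : Y ≅ Y') :
    HomVanishes X Y ↔ HomVanishes X' Y' :=
  ⟨fun h => h.of_iso e e', fun h => h.of_iso e.symm e'.symm⟩

lemma compactObjects.homVanishes_sigma {A : C} (hA : compactObjects C A) {J : Type*} [Small.{v} J]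
    (X : J → C) [HasCoproduct X] (h : ∀ j, HomVanishes A (X j)) : HomVanishes A (∐ X) := fun f => by
  induction f using hA.sigma_induction X with
  | zero => rfl
  | add f g hf hg => rw [hf, hg, add_zero]
  | ι j f => rw [h j f, zero_comp]

variable [HasShift C ℤ] [∀ n : ℤ, (shiftFunctor C n).Additive]

lemma homVanishes_shift_shift_iff {X Y : C} {a b c : ℤ} (h : c + a = b) :
    HomVanishes (X⟦a⟧) (Y⟦b⟧) ↔ HomVanishes X (Y⟦c⟧) := by
  rw [homVanishes_congr (Iso.refl _) ((shiftFunctorAdd' C c a b h).app Y)]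
  refine ⟨fun H f => (shiftFunctor C a).map_injective (by rw [Functor.map_zero]; exact H _),
    fun H f => ?_⟩
  obtain ⟨g, rfl⟩ := (shiftFunctor C a).map_surjective f
  rw [H g, Functor.map_zero]

lemma homVanishes_shift_left_iff {X Y : C} {a b : ℤ} (h : b + a = 0) :
    HomVanishes (X⟦a⟧) Y ↔ HomVanishes X (Y⟦b⟧) := by
  exact (homVanishes_congr (Iso.refl _) ((shiftFunctorZero C ℤ).symm.app Y)).trans
    (homVanishes_shift_shift_iff h)

omit [∀ n : ℤ, (shiftFunctor C n).Additive] in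
lemma homVanishes_shift_right_iff {X Y : C} {a b c : ℤ} (h : a + b = c) :
    HomVanishes X (Y⟦a⟧⟦b⟧) ↔ HomVanishes X (Y⟦c⟧) :=
  homVanishes_congr (Iso.refl _) ((shiftFunctorAdd' C a b c h).symm.app Y)

end Orthogonality

/-! ### From `M` to all compact objects -/

section Devissage

variable {C : Type u} [Category.{v} C] [Preadditive C] [HasZeroObject C] [HasShift C ℤ]
  [∀ n : ℤ, (shiftFunctor C n).Additive] [Pretriangulated C]

lemma homVanishes_obj₂ {X Y Z A : C} {f : X ⟶ Y} {g : Y ⟶ Z} {h : Z ⟶ X⟦(1 : ℤ)⟧}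
    (hT : Triangle.mk f g h ∈ distTriang C) (hX : HomVanishes A X) (hZ : HomVanishes A Z) :
    HomVanishes A Y := fun k => by
  obtain ⟨l, rfl⟩ := distTriang_lift₁ hT k (hZ _)
  rw [hX l, zero_comp]

lemma homVanishes_from_obj₂ {X Y Z A : C} {f : X ⟶ Y} {g : Y ⟶ Z} {h : Z ⟶ X⟦(1 : ℤ)⟧}
    (hT : Triangle.mk f g h ∈ distTriang C) (hX : HomVanishes X A) (hZ : HomVanishes Z A) :
    HomVanishes Y A := fun k => by
  obtain ⟨l, rfl⟩ := distTriang_desc₃ hT k (hX _)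
  rw [hZ l, comp_zero]

/-- The objects `X` such that `Hom(X, Y⟦n⟧) = 0` for all `n` in some set of the filter `l`. -/
def eventuallyOrthogonal (l : Filter ℤ) (Y : C) : ObjectProperty C :=
  fun X => ∀ᶠ n in l, HomVanishes X (Y⟦n⟧)

/-- The eventually orthogonal objects form a thick subcategory; translation invariance of `l` gives
stability under shifts. The cofinite filter serves for boundedness, `⊤` for generation. -/
lemma triangEnvelope_le_eventuallyOrthogonal [IsTriangulated C] {l : Filter ℤ}
    (hl : ∀ a : ℤ, Filter.Tendsto (· + a) l l) {M Y : C}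
    (h : ∀ᶠ n in l, HomVanishes M (Y⟦n⟧)) :
    (ObjectProperty.singleton M).triangEnvelope ≤ eventuallyOrthogonal l Y := by
  have h₀ : (eventuallyOrthogonal l Y).IsStableUnderRetracts :=
    { of_retract := fun {X X'} r hX' => Filter.Eventually.mono hX' fun n hn f => by
        rw [← Category.id_comp f, ← r.retract, Category.assoc, hn (r.r ≫ f), comp_zero] }
  have h₁ : (eventuallyOrthogonal l Y).ContainsZero :=
    { exists_zero := ⟨_, isZero_zero C, .of_forall fun n f => (isZero_zero C).eq_of_src _ _⟩ }
  have h₂ : (eventuallyOrthogonal l Y).IsStableUnderShift ℤ :=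
    { isStableUnderShiftBy := fun a =>
        { le_shift := fun X hX => ((hl (-a)).eventually hX).mono fun n hn =>
            (homVanishes_shift_shift_iff (by omega)).2 hn } }
  have h₃ : (eventuallyOrthogonal l Y).IsTriangulatedClosed₂ := .mk' fun T hT h₁ h₃ => by
    filter_upwards [h₁, h₃] with n hn₁ hn₃
    exact homVanishes_from_obj₂ hT hn₁ hn₃
  have h₄ : (eventuallyOrthogonal l Y).IsTriangulated := { }
  rw [ObjectProperty.triangEnvelope_le_iff]
  rintro X ⟨⟩
  exact h

lemma exists_nat_lt_abs_iff_eventually {p : ℤ → Prop} :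
    (∃ N : ℕ, ∀ n : ℤ, (N : ℤ) < |n| → p n) ↔ ∀ᶠ n in Filter.cofinite, p n := by
  rw [Int.cofinite_eq, Filter.eventually_sup, Filter.eventually_atBot, Filter.eventually_atTop]
  constructor
  · rintro ⟨N, hN⟩
    exact ⟨⟨-N - 1, fun n hn => hN n (lt_abs.2 (by omega))⟩,
      ⟨N + 1, fun n hn => hN n (lt_abs.2 (by omega))⟩⟩
  · rintro ⟨⟨a, ha⟩, ⟨b, hb⟩⟩
    refine ⟨a.natAbs + b.natAbs, fun n hn => ?_⟩
    rcases lt_abs.1 hn with h | h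
    · exact hb n (by omega)
    · exact ha n (by omega)

omit [HasZeroObject C] [∀ n : ℤ, (shiftFunctor C n).Additive] [Pretriangulated C] in
lemma rightFarAway_iff {P : ObjectProperty C} {t : C} :
    rightFarAway P t ↔ ∀ x : C, P x → ∀ᶠ n : ℤ in Filter.cofinite, HomVanishes x (t⟦n⟧) :=
  forall_congr' fun (x : C) => imp_congr_right fun _ => exists_nat_lt_abs_iff_eventually (p := fun n => HomVanishes x (t⟦n⟧))

omit [HasZeroObject C] [∀ n : ℤ, (shiftFunctor C n).Additive] [Pretriangulated C] in
lemma leftFarAway_iff {P : ObjectProperty C} {t : C} :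
    leftFarAway P t ↔ ∀ x : C, P x → ∀ᶠ n : ℤ in Filter.cofinite, HomVanishes t (x⟦n⟧) :=
  forall_congr' fun (x : C) => imp_congr_right fun _ => exists_nat_lt_abs_iff_eventually (p := fun n => HomVanishes t (x⟦n⟧))

lemma tendsto_add_cofinite (a : ℤ) : Filter.Tendsto (· + a) Filter.cofinite Filter.cofinite :=
  (add_left_injective a).tendsto_cofinite

omit [HasZeroObject C] [∀ n : ℤ, (shiftFunctor C n).Additive] [Pretriangulated C] in
lemma siltingHeart_iff {M y : C} :
    siltingHeart M y ↔ ∀ i : ℤ, i ≠ 0 → HomVanishes M (y⟦i⟧) :=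
  ⟨fun h i hi => h M ((ObjectProperty.singleton_iff ..).2 rfl) i hi, fun h x hx i hi => by obtain rfl := (ObjectProperty.singleton_iff ..).1 hx; exact h i hi⟩

namespace IsCompactSilting

variable {M : C} (hM : IsCompactSilting M)
include hM

lemma compact_shift [IsTriangulated C] {X : C} (hX : compactObjects C X) (n : ℤ) :
    compactObjects C (X⟦n⟧) := by
  rw [← hM.thick_eq] at hX ⊢
  exact (ObjectProperty.singleton M).triangEnvelope.le_shift n _ hX

lemma boundedObjects_iff [IsTriangulated C] {t : C} :
    boundedObjects C t ↔ ∀ᶠ n : ℤ in Filter.cofinite, HomVanishes M (t⟦n⟧) := by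
  rw [boundedObjects, rightFarAway_iff]
  refine ⟨fun h => h M hM.compact, fun h (x : C) hx => ?_⟩
  rw [← hM.thick_eq] at hx
  exact triangEnvelope_le_eventuallyOrthogonal tendsto_add_cofinite h x hx

lemma isZero_of_homVanishes [IsTriangulated C] (hC : IsCompactlyGenerated C) {Y : C}
    (h : ∀ n : ℤ, HomVanishes M (Y⟦n⟧)) : IsZero Y := by
  obtain ⟨ι, G, hG, hY⟩ := hC.exists_generators
  refine hY Y fun i n => ?_
  have hi := hG i
  rw [← hM.thick_eq] at hi
  have := triangEnvelope_le_eventuallyOrthogonal (l := ⊤) (fun _ => Filter.tendsto_top)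
    (Filter.eventually_top.2 h) _ hi
  exact Filter.eventually_top.1 this n

lemma homVanishes_shift_shift {m n : ℤ} (h : m < n) : HomVanishes (M⟦m⟧) (M⟦n⟧) :=
  (homVanishes_shift_shift_iff (c := n - m) (by omega)).2 (hM.hom_shift_eq_zero _ (by omega))

end IsCompactSilting

end Devissage

/-! ### Truncations and test objects by attaching cells -/

section CellAttachment

variable {C : Type u} [Category.{v} C] [Preadditive C] [HasZeroObject C] [HasShift C ℤ]
  [∀ n : ℤ, (shiftFunctor C n).Additive] [Pretriangulated C] [IsTriangulated C]
  [HasCoproducts.{v} C] {M : C}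

namespace IsCompactSilting

variable (hM : IsCompactSilting M)
include hM

/-- `X'` is the cone of the sum of all maps `M[n] ⟶ X` with `n ≥ k`. By silting, `Hom(M[n], -)`
kills this sum and its shift by `1` for `n < k`, so those degrees are unchanged. -/
lemma exists_truncation_step (k : ℤ) (X : C) : ∃ (X' : C) (φ : X ⟶ X'),
    (∀ n, k ≤ n → ∀ f : M⟦n⟧ ⟶ X, f ≫ φ = 0) ∧
    (∀ n, n < k → ∀ f : M⟦n⟧ ⟶ X, f ≫ φ = 0 → f = 0) ∧
    (∀ n, n < k → ∀ g : M⟦n⟧ ⟶ X', ∃ f, f ≫ φ = g) ∧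
    ∀ Y, (∀ n, k ≤ n → HomVanishes (M⟦n⟧) Y) → ∀ f : X ⟶ Y, ∃ g, φ ≫ g = f := by
  let B : (Σ n : {n : ℤ // k ≤ n}, (M⟦n.1⟧ ⟶ X)) → C := fun j => M⟦j.1.1⟧
  obtain ⟨X', φ, h, hT⟩ := distinguished_cocone_triangle (Sigma.desc (f := B) fun j => j.2)
  have hB : ∀ n, n < k → HomVanishes (M⟦n⟧) (∐ B) := fun n hn =>
    (hM.compact_shift hM.compact n).homVanishes_sigma B fun j =>
      hM.homVanishes_shift_shift (hn.trans_le j.1.2)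
  refine ⟨X', φ, fun n hn f => ?_, fun n hn f hf => ?_, fun n hn g => ?_, fun Y hY f => ?_⟩
  · have h₁ : Sigma.ι B ⟨⟨n, hn⟩, f⟩ ≫ Sigma.desc (f := B) (fun j => j.2) = f :=
      Sigma.ι_desc _ _
    rw [← h₁, Category.assoc, distTriang_mor_zero₁₂ hT, comp_zero]
  · obtain ⟨g, rfl⟩ := distTriang_lift₁ hT f hf
    rw [hB n hn g, zero_comp]
  · refine distTriang_lift₂ hT g ((homVanishes_shift_shift_iff (c := 1 - n) (by omega)).2
      ((homVanishes_shift_left_iff (a := n - 1) (by omega)).1 (hB _ (by omega))) _)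
  · exact distTriang_desc₃ hT f (Sigma.hom_ext _ _ fun j => by
      rw [comp_zero]
      exact hY _ j.1.2 _)

/-- The truncation triangle of the t-structure attached to `M`, described by the
map `X ⟶ L` to the coaisle part. -/
lemma exists_truncation (k : ℤ) (X : C) : ∃ (L : C) (ι : X ⟶ L),
    (∀ n, k ≤ n → HomVanishes (M⟦n⟧) L) ∧
    (∀ n, n < k → ∀ f : M⟦n⟧ ⟶ X, f ≫ ι = 0 → f = 0) ∧
    (∀ n, n < k → ∀ g : M⟦n⟧ ⟶ L, ∃ f, f ≫ ι = g) ∧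
    ∀ Y, (∀ n, k ≤ n → HomVanishes (M⟦n⟧) Y) → ∀ f : X ⟶ Y, ∃ g, ι ≫ g = f := by
  choose S σ h₁ h₂ h₃ h₄ using hM.exists_truncation_step k
  let Z : ℕ → C := fun n => Nat.rec X (fun _ => S) n
  let φ : ∀ n, Z n ⟶ Z (n + 1) := fun n => σ (Z n)
  have := has_smallest_coproducts_of_hasCoproducts.{v} (C := C)
  obtain ⟨L, ι, hι, hfac, hinj, hdesc, -⟩ := exists_homotopyColimit Z φ
  have hfac' (n : ℤ) (f : M⟦n⟧ ⟶ L) : ∃ m g, f = g ≫ ι m := 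
    hfac _ (hM.compact_shift hM.compact n)
      (hM.compact_shift (hM.compact_shift hM.compact n) (-1)) f
  refine ⟨L, ι 0, fun n hn f => ?_, fun n hn f hf => ?_, fun n hn f => ?_, fun Y hY f => ?_⟩
  · obtain ⟨m, g, rfl⟩ := hfac' n f
    rw [← hι, ← Category.assoc, h₁ _ _ hn, zero_comp]
  · exact hinj _ (hM.compact_shift hM.compact n) (fun m g => h₂ (Z m) n hn g) 0 f hf
  · obtain ⟨m, g, rfl⟩ := hfac' n f
    induction m with
    | zero => exact ⟨g, rfl⟩
    | succ m ih =>
      obtain ⟨g', rfl⟩ := h₃ (Z m) n hn g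
      obtain ⟨f, hf⟩ := ih g'
      exact ⟨f, by rw [hf, Category.assoc, ← hι]⟩
  · choose e he using fun m (g : Z m ⟶ Y) => h₄ (Z m) Y hY g
    let ψ : ∀ m, Z m ⟶ Y := fun m => Nat.rec f (fun m g => e m g) m
    obtain ⟨ψ', hψ'⟩ := hdesc Y ψ fun m => he m (ψ m)
    exact ⟨ψ', hψ' 0⟩

omit [IsTriangulated C] in
-- Coning off all maps that `χ` fails to detect is harmless to `χ`: it vanishes on their
-- contribution to `Hom(M, X)`, so it extends.
lemma exists_character_step (X : C) (χ : CharacterModule (M ⟶ X)) :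
    ∃ (X' : C) (φ : X ⟶ X') (χ' : CharacterModule (M ⟶ X')), (∀ f, χ' (f ≫ φ) = χ f) ∧
      ∀ (n : ℤ) (f : M⟦n⟧ ⟶ X), (∀ g : M ⟶ M⟦n⟧, χ (g ≫ f) = 0) → f ≫ φ = 0 := by
  let B : (Σ n : ℤ, {f : M⟦n⟧ ⟶ X // ∀ g : M ⟶ M⟦n⟧, χ (g ≫ f) = 0}) → C := fun j => M⟦j.1⟧
  let p : ∐ B ⟶ X := Sigma.desc fun j => j.2.1
  obtain ⟨X', φ, h, hT⟩ := distinguished_cocone_triangle p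
  obtain ⟨χ', hχ'⟩ := distTriang_exists_character hT χ fun k => by
    induction k using hM.compact.sigma_induction B with
    | zero => rw [zero_comp, map_zero]
    | add f g hf hg => rw [Preadditive.add_comp, map_add, hf, hg, add_zero]
    | ι j f =>
      rw [Category.assoc, Sigma.ι_desc]
      exact j.2.2 f
  refine ⟨X', φ, χ', hχ', fun n f hf => ?_⟩
  have h₁ : Sigma.ι B ⟨n, f, hf⟩ ≫ p = f := Sigma.ι_desc _ _
  rw [← h₁, Category.assoc, distTriang_mor_zero₁₂ hT, comp_zero]

/-- A variant of Brown representability: every character of `Hom(M, X)` extends along some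
`X ⟶ I` to a character of `Hom(M, I)` that detects the morphisms `M⟦n⟧ ⟶ I`. -/
lemma exists_character_detecting (X : C) (χ : CharacterModule (M ⟶ X)) :
    ∃ (I : C) (ι : X ⟶ I) (χ' : CharacterModule (M ⟶ I)), (∀ f, χ' (f ≫ ι) = χ f) ∧
      ∀ (n : ℤ) (f : M⟦n⟧ ⟶ I), (∀ g : M ⟶ M⟦n⟧, χ' (g ≫ f) = 0) → f = 0 := by
  choose S σ τ h₁ h₂ using hM.exists_character_step
  let Z : ℕ → Σ X : C, CharacterModule (M ⟶ X) :=
    fun n => Nat.rec ⟨X, χ⟩ (fun _ p => ⟨S p.1 p.2, τ p.1 p.2⟩) n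
  have := has_smallest_coproducts_of_hasCoproducts.{v} (C := C)
  obtain ⟨I, ι, hι, hfac, -, -, hchar⟩ :=
    exists_homotopyColimit (fun n => (Z n).1) fun n => σ (Z n).1 (Z n).2
  obtain ⟨χ', hχ'⟩ := hchar M hM.compact (fun n => (Z n).2) fun n f => h₁ _ _ f
  refine ⟨I, ι 0, χ', hχ' 0, fun n f hf => ?_⟩
  obtain ⟨m, g, rfl⟩ := hfac _ (hM.compact_shift hM.compact n)
    (hM.compact_shift (hM.compact_shift hM.compact n) (-1)) f
  -- If `χ'` does not detect `f`, the character at stage `m` does not detect `g`, which therefore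
  -- dies at stage `m + 1`.
  rw [← hι, ← Category.assoc, h₂ _ _ n g fun h => by
    rw [← hχ', Category.assoc]; exact hf h, zero_comp]

end IsCompactSilting

end CellAttachment

/-! ### Finiteness of the dimensions as uniform vanishing -/

lemma sInf_coe_le_coe_iff {p : ℤ → Prop} (hp : ∀ m n, m ≤ n → p m → p n) (n : ℤ) :
    sInf {m | ∃ n : ℤ, m = ((n : WithTop ℤ) : WithBot (WithTop ℤ)) ∧ p n} ≤
      ((n : WithTop ℤ) : WithBot (WithTop ℤ)) ↔ p n := by
  refine ⟨fun h => ?_, fun h => sInf_le ⟨n, rfl, h⟩⟩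
  -- Being strictly below `n + 1` produces an actual integer `m ≤ n` in the set.
  have h' : sInf {m | ∃ n : ℤ, m = ((n : WithTop ℤ) : WithBot (WithTop ℤ)) ∧ p n} <
      (((n + 1 : ℤ) : WithTop ℤ) : WithBot (WithTop ℤ)) :=
    h.trans_lt (WithBot.coe_lt_coe.2 (WithTop.coe_lt_coe.2 (by omega)))
  obtain ⟨_, ⟨m, rfl, hm⟩, hmn⟩ := sInf_lt_iff.1 h'
  have := WithTop.coe_lt_coe.1 (WithBot.coe_lt_coe.1 hmn)
  exact hp m n (by omega) hm

section

variable {C : Type u} [Category.{v} C] [Preadditive C] [HasShift C ℤ]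

lemma projDim_le_iff {ℋ : ObjectProperty C} {x : C} {n : ℤ} :
    projDim ℋ x ≤ ((n : WithTop ℤ) : WithBot (WithTop ℤ)) ↔
      ∀ y : C, ℋ y → ∀ i : ℤ, n < i → HomVanishes x (y⟦i⟧) :=
  sInf_coe_le_coe_iff (p := fun n => ∀ y : C, ℋ y → ∀ i : ℤ, n < i → HomVanishes x (y⟦i⟧))
    (fun _ _ hmn h y hy i hi => h y hy i (hmn.trans_lt hi)) n

lemma globalDim_lt_top_iff {ℋ : ObjectProperty C} :
    globalDim ℋ < ⊤ ↔
      ∃ n : ℤ, ∀ x y : C, ℋ x → ℋ y → ∀ i : ℤ, n < i → HomVanishes x (y⟦i⟧) := by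
  rw [globalDim, sInf_lt_iff]
  constructor
  · rintro ⟨_, ⟨n, rfl, hn⟩, -⟩
    exact ⟨n, fun x y hx hy => projDim_le_iff.1 (hn x hx) y hy⟩
  · rintro ⟨n, hn⟩
    exact ⟨_, ⟨n, rfl, fun x hx => projDim_le_iff.2 fun y hy => hn x y hx hy⟩,
      WithBot.coe_lt_coe.2 (WithTop.coe_lt_top n)⟩

end

/-! ### Bounded objects and the heart -/

section Bounded

variable {C : Type u} [Category.{v} C] [Preadditive C] [HasZeroObject C] [HasShift C ℤ]
  [∀ n : ℤ, (shiftFunctor C n).Additive] [Pretriangulated C]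

/-- Any two bounded objects have only finitely many nonzero extension groups. -/
def BoundedExt (C : Type u) [Category.{v} C] [Preadditive C] [HasShift C ℤ] : Prop :=
  ∀ t s : C, boundedObjects C t → boundedObjects C s →
    ∀ᶠ n : ℤ in Filter.cofinite, HomVanishes t (s⟦n⟧)

omit [HasZeroObject C] [∀ n : ℤ, (shiftFunctor C n).Additive] [Pretriangulated C] in
lemma boundedObjects_le_boundedProjectives_iff :
    boundedObjects C ≤ boundedProjectives C ↔ BoundedExt C :=
  ⟨fun h t s ht hs => leftFarAway_iff.1 (h t ht) s hs,
    fun h t ht => leftFarAway_iff.2 fun s hs => h t s ht hs⟩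

omit [HasZeroObject C] [∀ n : ℤ, (shiftFunctor C n).Additive] [Pretriangulated C] in
lemma boundedObjects_le_boundedInjectives_iff :
    boundedObjects C ≤ boundedInjectives C ↔ BoundedExt C :=
  ⟨fun h t s ht hs => rightFarAway_iff.1 (h s hs) t ht,
    fun h s hs => rightFarAway_iff.2 fun t ht => h t s ht hs⟩

omit [HasZeroObject C] [∀ n : ℤ, (shiftFunctor C n).Additive] [Pretriangulated C] in
lemma siltingHeart_shift {M t : C} {a : ℤ} (h : ∀ i, i ≠ a → HomVanishes M (t⟦i⟧)) :
    siltingHeart M (t⟦a⟧) :=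
  siltingHeart_iff.2 fun i hi =>
    (homVanishes_shift_right_iff (c := a + i) rfl).2 (h _ (by omega))

namespace IsCompactSilting

variable [IsTriangulated C] {M : C} (hM : IsCompactSilting M) (hC : IsCompactlyGenerated C)
include hM hC

/-- Any `x ⟶ y` factors through the coaisle truncation of `x`, which is zero because no shift of `M`
maps to it nontrivially. -/
lemma homVanishes_of_aisle_of_coaisle {x y : C} (hx : ∀ i : ℤ, 0 < i → HomVanishes M (x⟦i⟧))
    (hy : ∀ i : ℤ, i ≤ 0 → HomVanishes M (y⟦i⟧)) : HomVanishes x y := by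
  have := hC.hasCoproducts
  obtain ⟨L, ι, h₁, -, h₃, h₄⟩ := hM.exists_truncation 0 x
  have hL : IsZero L := hM.isZero_of_homVanishes hC fun i => by
    rw [← homVanishes_shift_left_iff (a := -i) (by omega)]
    rcases le_or_gt i 0 with hi | hi
    · exact h₁ _ (by omega)
    · intro g
      obtain ⟨f, rfl⟩ := h₃ (-i) (by omega) g
      rw [(homVanishes_shift_left_iff (by omega)).2 (hx i hi) f, zero_comp]
  intro f
  obtain ⟨g, rfl⟩ := h₄ y (fun n hn => (homVanishes_shift_left_iff (b := -n) (by omega)).2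
    (hy _ (by omega))) f
  rw [hL.eq_of_src g 0, comp_zero]

/-- Induction on the length of an interval `[a, a + k)` containing all `i` with `Hom(M, t[i]) ≠ 0`.
Truncation splits off the part in degree `a`, leaving `[a + 1, a + 1 + k)` when the length is `k +
1`. -/
lemma bounded_induction {Q : C → Prop}
    (concentrated : ∀ (t : C) (a : ℤ), (∀ i, i ≠ a → HomVanishes M (t⟦i⟧)) → Q t)
    (ext : ∀ {X Y Z : C} {f : X ⟶ Y} {g : Y ⟶ Z} {h : Z ⟶ X⟦(1 : ℤ)⟧},
      Triangle.mk f g h ∈ distTriang C → Q X → Q Z → Q Y)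
    {t : C} (ht : boundedObjects C t) : Q t := by
  have := hC.hasCoproducts
  suffices ∀ (k : ℕ) (a : ℤ) (t : C), (∀ i, i < a ∨ a + k ≤ i → HomVanishes M (t⟦i⟧)) → Q t by
    obtain ⟨N, hN⟩ := exists_nat_lt_abs_iff_eventually.2 (hM.boundedObjects_iff.1 ht)
    exact this (2 * N + 1) (-N) t fun i hi => hN i (lt_abs.2 (by omega))
  intro k
  induction k with
  | zero => exact fun a t h => concentrated t 0 fun i _ => h i (by omega)
  | succ k ih =>
    intro a t h
    obtain ⟨L, ι, h₁, h₂, h₃, -⟩ := hM.exists_truncation (-a) t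
    obtain ⟨W, w, d, hT⟩ := distinguished_cocone_triangle₁ ι
    refine ext hT (concentrated W a fun i hi => ?_) (ih (a + 1) L fun i hi => ?_)
    · rw [← homVanishes_shift_left_iff (a := -i) (by omega)]
      intro f
      have hf : f ≫ w = 0 := by
        rcases lt_or_gt_of_ne hi with hi | hi
        · exact (homVanishes_shift_left_iff (by omega)).2 (h i (by omega)) _
        · exact h₂ (-i) (by omega) _ (by
            rw [Category.assoc, distTriang_mor_zero₁₂ hT, comp_zero])
      obtain ⟨g, hg⟩ := distTriang_lift₃ hT (f⟦(1 : ℤ)⟧')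
        (by rw [← Functor.map_comp, hf, Functor.map_zero])
      let e : M⟦-i + 1⟧ ≅ M⟦-i⟧⟦(1 : ℤ)⟧ := (shiftFunctorAdd' C (-i) 1 _ rfl).app M
      -- Here `f[1]` comes from a map `M[-i + 1] ⟶ L`, which either lifts to `t` and so dies under
      -- `d`, or is already zero.
      have he : (e.hom ≫ g) ≫ d = 0 := by
        by_cases hi' : -i + 1 < -a
        · obtain ⟨l, hl⟩ := h₃ _ hi' (e.hom ≫ g)
          rw [← hl, Category.assoc, distTriang_mor_zero₂₃ hT, comp_zero]
        · rw [h₁ _ (by omega) (e.hom ≫ g), zero_comp]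
      refine (shiftFunctor C (1 : ℤ)).map_injective ?_
      rw [Functor.map_zero, ← hg, ← cancel_epi e.hom, ← Category.assoc, he, comp_zero]
    · rw [← homVanishes_shift_left_iff (a := -i) (by omega)]
      rcases le_or_gt i a with hi' | hi'
      · exact h₁ _ (by omega)
      · intro g
        obtain ⟨f, rfl⟩ := h₃ (-i) (by omega) g
        rw [(homVanishes_shift_left_iff (by omega)).2 (h i (by omega)) f, zero_comp]

lemma boundedExt_of_globalDim_lt_top (h : globalDim (siltingHeart M) < ⊤) : BoundedExt C := by
  obtain ⟨N, hN⟩ := globalDim_lt_top_iff.1 h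
  intro t s ht hs
  refine hM.bounded_induction hC (Q := fun t => ∀ᶠ n : ℤ in Filter.cofinite, HomVanishes t (s⟦n⟧))
    (fun t a ha => ?_) (fun hT h₁ h₃ => ?_) ht
  · refine hM.bounded_induction hC
      (Q := fun s => ∀ᶠ n : ℤ in Filter.cofinite, HomVanishes t (s⟦n⟧))
      (fun s b hb => ?_) (fun hT h₁ h₃ => ?_) hs
    · have hx := siltingHeart_shift ha
      have hy := siltingHeart_shift hb
      rw [← exists_nat_lt_abs_iff_eventually]
      refine ⟨N.natAbs + a.natAbs + b.natAbs, fun n hn => ?_⟩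
      -- `Hom(t, s[n])` becomes `Hom(t[a], s[b][n + a - b])`, with both `t[a]` and `s[b]` in the
      -- heart.
      rw [← homVanishes_shift_shift_iff (a := a) (b := n + a) rfl,
        ← homVanishes_shift_right_iff (a := b) (b := n + a - b) (by omega)]
      rcases lt_abs.1 hn with hn | hn
      · exact hN _ _ hx hy _ (by omega)
      · refine hM.homVanishes_of_aisle_of_coaisle hC
          (fun i hi => siltingHeart_iff.1 hx i hi.ne') fun i hi => ?_
        rw [homVanishes_shift_right_iff rfl]
        exact siltingHeart_iff.1 hy _ (by omega)
    · filter_upwards [h₁, h₃] with n hn₁ hn₃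
      rw [← homVanishes_shift_left_iff (a := -n) (by omega)] at hn₁ hn₃ ⊢
      exact homVanishes_obj₂ hT hn₁ hn₃
  · filter_upwards [h₁, h₃] with n hn₁ hn₃
    exact homVanishes_from_obj₂ hT hn₁ hn₃

omit hC in
lemma boundedObjects_of_siltingHeart {x : C} (hx : siltingHeart M x) : boundedObjects C x :=
  hM.boundedObjects_iff.2 ((Filter.eventually_cofinite_ne 0).mono (siltingHeart_iff.1 hx))

omit hC in
lemma siltingHeart_sigma {J : Type*} [Small.{v} J] (x : J → C) [HasCoproduct x]
    (hx : ∀ j, siltingHeart M (x j)) : siltingHeart M (∐ x) :=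
  siltingHeart_iff.2 fun i hi => (homVanishes_shift_left_iff (a := -i) (by omega)).1 <|
    (hM.compact_shift hM.compact (-i)).homVanishes_sigma x fun j =>
      (homVanishes_shift_left_iff (by omega)).2 (siltingHeart_iff.1 (hx j) i hi)

lemma globalDim_lt_top_of_boundedExt (h : BoundedExt C) : globalDim (siltingHeart M) < ⊤ := by
  have := hC.hasCoproducts
  have := has_smallest_coproducts_of_hasCoproducts.{v} (C := C)
  rw [globalDim_lt_top_iff]
  by_contra! H
  choose x y hx hy i hi hxy using fun n : ℕ => H n
  obtain ⟨N, hN⟩ := exists_nat_lt_abs_iff_eventually.2 (h (∐ x) (∐ y)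
    (hM.boundedObjects_of_siltingHeart (hM.siltingHeart_sigma x hx))
    (hM.boundedObjects_of_siltingHeart (hM.siltingHeart_sigma y hy)))
  refine hxy N fun f => ?_
  -- `Hom(x N, y N[i N])` is a retract of the corresponding group for the coproducts, where `i N >
  -- N` forces vanishing.
  have h₀ := hN (i N) (lt_abs.2 (Or.inl (hi N))) (sigmaProj x N ≫ f ≫ (Sigma.ι y N)⟦i N⟧')
  have h₁ := congrArg (fun g => Sigma.ι x N ≫ g ≫ (sigmaProj y N)⟦i N⟧') h₀
  simp only [Category.assoc, ← Functor.map_comp, ι_sigmaProj_self, zero_comp, comp_zero] at h₁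
  simpa [← Category.assoc, ι_sigmaProj_self] using h₁

lemma globalDim_lt_top_iff_boundedExt : globalDim (siltingHeart M) < ⊤ ↔ BoundedExt C :=
  ⟨hM.boundedExt_of_globalDim_lt_top hC, hM.globalDim_lt_top_of_boundedExt hC⟩

/-- Separating characters of all `Hom(M, t[n])` are glued on `∐ t[n]` and extended to one test
object `I`. The hypothesis on `M` makes `I` bounded, so `t[n] ⟶ I` is zero for almost all `n`, and
the `n`-th character with it. -/
lemma boundedProjectives_le_boundedObjects
    (h : rightFarAway (ObjectProperty.singleton M) M) :
    boundedProjectives C ≤ boundedObjects C := by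
  have := hC.hasCoproducts
  have := has_smallest_coproducts_of_hasCoproducts.{v} (C := C)
  intro t ht
  have hχ (n : ℤ) : ∃ χ : CharacterModule (M ⟶ t⟦n⟧), (∀ f, χ f = 0) → HomVanishes M (t⟦n⟧) := by
    by_cases hn : HomVanishes M (t⟦n⟧)
    · exact ⟨0, fun _ => hn⟩
    · obtain ⟨f, hf⟩ := not_forall.1 hn
      obtain ⟨χ, hχ⟩ := CharacterModule.exists_character_apply_ne_zero_of_ne_zero hf
      exact ⟨χ, fun h => (hχ (h f)).elim⟩
  choose χ hχ using hχ
  obtain ⟨χ', hχ'⟩ := hM.compact.exists_sigma_desc (fun n : ℤ => t⟦n⟧) χ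
  obtain ⟨I, ι, η, hη, hI⟩ := hM.exists_character_detecting _ χ'
  have hIb : boundedObjects C I := hM.boundedObjects_iff.2 <| by
    have hMM := rightFarAway_iff.1 h M ((ObjectProperty.singleton_iff ..).2 rfl)
    filter_upwards [neg_injective.tendsto_cofinite.eventually hMM] with n hn
    -- For almost all `n` there is no nonzero `g : M ⟶ M[-n]`, so the detection property holds
    -- vacuously and forces `f = 0`.
    refine (homVanishes_shift_left_iff (a := -n) (by omega)).1 fun f => hI _ f fun g => ?_
    rw [hn g, zero_comp, map_zero]
  rw [hM.boundedObjects_iff]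
  filter_upwards [neg_injective.tendsto_cofinite.eventually (leftFarAway_iff.1 ht I hIb)] with n hn
  refine hχ n fun f => ?_
  rw [← homVanishes_shift_left_iff (a := n) (by omega)] at hn
  rw [← hχ', ← hη, Category.assoc, hn (Sigma.ι (fun n : ℤ => t⟦n⟧) n ≫ ι), comp_zero, map_zero]

end IsCompactSilting

end Bounded

end RelGlobalDim

theorem theorem2p9 {T : Type u} [Category.{v} T] [Preadditive T] [HasZeroObject T] [HasShift T ℤ]
    [∀ n : ℤ, (shiftFunctor T n).Additive] [Pretriangulated T] [IsTriangulated T]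
    (hT : RelGlobalDim.IsCompactlyGenerated T)
    (M : T) (hM : RelGlobalDim.IsCompactSilting M) :
    List.TFAE
      [ RelGlobalDim.globalDim (RelGlobalDim.siltingHeart M) < ⊤,
        RelGlobalDim.boundedObjects T ≤ RelGlobalDim.boundedProjectives T,
        RelGlobalDim.boundedObjects T ≤ RelGlobalDim.boundedInjectives T ] ∧
    (RelGlobalDim.rightFarAway (ObjectProperty.singleton M) M →
      (RelGlobalDim.globalDim (RelGlobalDim.siltingHeart M) < ⊤ ↔
        RelGlobalDim.HasFiniteGlobalDimension T)) ∧
    (∀ N : T, RelGlobalDim.IsCompactSilting N →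
      (RelGlobalDim.globalDim (RelGlobalDim.siltingHeart M) < ⊤ ↔
        RelGlobalDim.globalDim (RelGlobalDim.siltingHeart N) < ⊤)) := by
  have h₂ := RelGlobalDim.boundedObjects_le_boundedProjectives_iff (C := T)
  have h₃ := RelGlobalDim.boundedObjects_le_boundedInjectives_iff (C := T)
  have h₁ := hM.globalDim_lt_top_iff_boundedExt hT
  refine ⟨?_, fun h => ?_, fun N hN => h₁.trans (hN.globalDim_lt_top_iff_boundedExt hT).symm⟩
  · tfae_have 1 ↔ 2 := h₁.trans h₂.symm
    tfae_have 2 ↔ 3 := h₂.trans h₃.symm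
    tfae_finish
  · rw [h₁, ← h₂]
    exact ⟨fun h' => le_antisymm h' (hM.boundedProjectives_le_boundedObjects hT h), le_of_eq⟩
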